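/- Let $r \ge 1$ and $\ell \ge 2$ be integers. For $n \ge 0$ let $b_\ell^{(r)}(n)$ be the number of $r$-colored $\ell$-regular partitions of $n$, i.e. the number of multisets of positive integers, none divisible by $\ell$, each carrying one of $r$ colors, whose sum is $n$; equivalently, $\sum_{n\ge 0} b_\ell^{(r)}(n) q^n = \prod_{n\ge 1}\left(\frac{1-q^{\ell n}}{1-q^n}\right)^r$. Then, for fixed $r$ and $\ell$, as $n \to \infty$, $$b_\ell^{(r)}(n) \sim \frac{1}{\sqrt{2}} \left(\frac{1}{\ell}\right)^{r/2} \left(\frac{r}{24}\left(1-\frac{1}{\ell}\right)\right)^{1/4} \left(\frac{1}{n}\right)^{3/4} \exp\left(4\pi\sqrt{\frac{nr}{24}\left(1-\frac{1}{\ell}\right)}\right).$$ -/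

import Mathlib

open Filter Asymptotics

/-- The `r`-colored `ℓ`-regular partitions of `n`: multisets of parts, each carrying one of `r`
colors, in which every part is positive and not divisible by `ℓ`, and the parts sum to `n`.
The pair `(a, c)` stands for the part `a` in the color `c`. -/
def coloredRegularPartitions (r ℓ n : ℕ) : Set (Multiset (ℕ × Fin r)) :=
  {P | (∀ x ∈ P, 0 < x.1 ∧ ¬ ℓ ∣ x.1) ∧ (P.map Prod.fst).sum = n}

/-- `b_ℓ^{(r)}(n)`, the number of `r`-colored `ℓ`-regular partitions of `n`. -/
noncomputable def coloredRegularCount (r ℓ n : ℕ) : ℕ :=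
  (coloredRegularPartitions r ℓ n).ncard

/-- The set counted by `coloredRegularCount` is finite, so the count is the true cardinality. -/
theorem finite_coloredRegularPartitions (r ℓ n : ℕ) :
    (coloredRegularPartitions r ℓ n).Finite := by
  classical
  refine (Set.finite_Iic
    (n • (Finset.range (n + 1) ×ˢ (Finset.univ : Finset (Fin r))).val)).subset ?_
  rintro P ⟨hP, hs⟩
  rw [Set.mem_Iic, Multiset.le_iff_count]
  intro x
  by_cases hx : x ∈ P
  · have h1 : x.1 ≤ n := hs ▸ Multiset.single_le_sum (by simp) _ (Multiset.mem_map_of_mem _ hx)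
    have h2 : Multiset.card P ≤ n := by
      have := Multiset.card_nsmul_le_sum (s := P.map Prod.fst) (a := 1) (by
        intro y hy
        obtain ⟨z, hz, rfl⟩ := Multiset.mem_map.mp hy
        exact (hP z hz).1)
      simpa [hs] using this
    have h3 : Multiset.count x (Finset.range (n + 1) ×ˢ (Finset.univ : Finset (Fin r))).val = 1 :=
      Multiset.count_eq_one_of_mem (Finset.nodup _) (by
        rw [Finset.mem_val, Finset.mem_product]; simp; omega)
    rw [Multiset.count_nsmul, h3]
    simpa using (Multiset.count_le_card x P).trans h2
  · simp [Multiset.count_eq_zero_of_notMem hx]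

/-- The generating function of `r`-colored `ℓ`-regular partitions is the `r`-th power of the
generating function of `ℓ`-regular partitions. -/
theorem mk_coloredRegularCount (r ℓ : ℕ) :
    (PowerSeries.mk fun n => (coloredRegularCount r ℓ n : ℤ)) =
      (PowerSeries.mk fun n =>
        ((Nat.Partition.restricted n (fun a => ¬ ℓ ∣ a)).card : ℤ)) ^ r := by
  classical
  ext n
  have hpow : ∀ f : PowerSeries ℤ, f ^ r = ∏ _i : Fin r, f := by simp
  rw [hpow, PowerSeries.coeff_prod]
  simp only [PowerSeries.coeff_mk]
  let T : Finset (Σ l : Fin r →₀ ℕ, ∀ i, Nat.Partition (l i)) :=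
    (Finset.finsuppAntidiag Finset.univ n).sigma fun l =>
      Fintype.piFinset fun i => Nat.Partition.restricted (l i) (fun a => ¬ ℓ ∣ a)
  let F : (Σ l : Fin r →₀ ℕ, ∀ i, Nat.Partition (l i)) → Multiset (ℕ × Fin r) :=
    fun p => ∑ i, (p.2 i).parts.map fun a => (a, i)
  have hrec : ∀ (g : Fin r → Multiset ℕ) (j : Fin r),
      ((∑ i, (g i).map fun a => (a, i)).filter fun x => x.2 = j).map Prod.fst = g j := by
    intro g j
    have h1 : (∑ i, (g i).map fun a => (a, i)).filter (fun x => x.2 = j)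
        = ∑ i, ((g i).map fun a => (a, i)).filter fun x => x.2 = j :=
      map_sum (⟨⟨Multiset.filter (fun x : ℕ × Fin r => x.2 = j), by simp⟩,
        fun a b => Multiset.filter_add _ a b⟩ : Multiset (ℕ × Fin r) →+ Multiset (ℕ × Fin r)) _ _
    rw [h1, Finset.sum_eq_single j]
    · simp [Multiset.filter_map]
    · intro i _ hij
      simp [Multiset.filter_map, hij]
    · simp
  have hinj : Function.Injective F := by
    rintro ⟨l, f⟩ ⟨l', f'⟩ h
    have hp : ∀ j, (f j).parts = (f' j).parts := fun j => by
      rw [← hrec (fun i => (f i).parts) j, ← hrec (fun i => (f' i).parts) j]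
      exact congrArg (fun P => (P.filter fun x => x.2 = j).map Prod.fst) h
    have hl : l = l' := by
      ext j
      rw [← (f j).parts_sum, ← (f' j).parts_sum, hp j]
    subst hl
    congr
    funext j
    exact Nat.Partition.ext (hp j)
  have hset : coloredRegularPartitions r ℓ n = F '' (T : Set _) := by
    ext P
    constructor
    · rintro ⟨hP, hs⟩
      let g : Fin r → Multiset ℕ := fun j => (P.filter fun x => x.2 = j).map Prod.fst
      have hg : ∀ j, ∀ a ∈ g j, 0 < a ∧ ¬ ℓ ∣ a := by
        intro j a ha
        obtain ⟨x, hx, rfl⟩ := Multiset.mem_map.mp ha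
        exact hP x (Multiset.mem_of_mem_filter hx)
      have hPg : (∑ i, (g i).map fun a => (a, i)) = P := by
        ext ⟨a, i⟩
        rw [Multiset.count_sum', Finset.sum_eq_single i]
        · have h2 : (g i).map (fun a => (a, i)) = P.filter fun x => x.2 = i := by
            simp only [g, Multiset.map_map, Function.comp_def]
            conv_rhs => rw [← Multiset.map_id (P.filter fun x => x.2 = i)]
            refine Multiset.map_congr rfl fun x hx => ?_
            rw [← (Multiset.mem_filter.mp hx).2]
            rfl
          rw [h2, Multiset.count_filter]
          simp
        · intro j _ hj
          refine Multiset.count_eq_zero_of_notMem fun hm => ?_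
          obtain ⟨b, _, hb⟩ := Multiset.mem_map.mp hm
          exact hj (congrArg Prod.snd hb)
        · simp
      refine ⟨⟨Finsupp.equivFunOnFinite.symm fun j => (g j).sum,
        fun j => ⟨g j, fun {a} ha => (hg j a ha).1, rfl⟩⟩, ?_, hPg⟩
      simp only [T, Finset.mem_coe, Finset.mem_sigma, Finset.mem_finsuppAntidiag,
        Fintype.mem_piFinset, Nat.Partition.restricted, Finset.mem_filter, Finset.mem_univ,
        true_and]
      refine ⟨⟨?_, by simp⟩, fun j a ha => (hg j a ha).2⟩
      rw [← hs, ← hPg, ← Multiset.coe_mapAddMonoidHom, map_sum, ← Multiset.coe_sumAddMonoidHom,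
        map_sum]
      simp [Multiset.map_map]
    · rintro ⟨⟨l, f⟩, hT, rfl⟩
      simp only [T, Finset.mem_coe, Finset.mem_sigma, Finset.mem_finsuppAntidiag,
        Fintype.mem_piFinset, Nat.Partition.restricted, Finset.mem_filter, Finset.mem_univ,
        true_and] at hT
      constructor
      · intro x hx
        obtain ⟨i, _, hi⟩ := Multiset.mem_sum.mp hx
        obtain ⟨a, ha, rfl⟩ := Multiset.mem_map.mp hi
        exact ⟨(f i).parts_pos ha, hT.2 i a ha⟩
      · rw [← Multiset.coe_mapAddMonoidHom, map_sum, ← Multiset.coe_sumAddMonoidHom, map_sum]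
        simp [Multiset.map_map, (f _).parts_sum, hT.1.1]
  rw [coloredRegularCount, hset, Set.ncard_image_of_injective _ hinj, Set.ncard_coe_finset,
    Finset.card_sigma]
  simp [Fintype.card_piFinset]

/-! This is the circle method in which the cusp `q = 1` alone contributes, so a single saddle point
suffices. Write `F(q)` for the generating function, the `r`-th power of `regularGen ℓ q`, and `A`
for `growthRate r ℓ`. The transformation law of the Dedekind eta function, used at `t` and at `ℓ t`,
gives the exact identity `F(exp(-t)) = ℓ^(-r/2) exp(r(ℓ-1)t/24) exp(A/t) · cuspFactor`
(`regularGen_exp_neg_pow`), whose last factor tends to `1` as `Re(1/t) → ∞`.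

In Cauchy's formula (`integral_regularGen_pow`) the exponent `A/t + n t` has its saddle at `t = s²`
with `s⁴ = A/n`. Putting `t = s²(1 + i s u)`, that is, angle `y = s³u`, turns the exponent into
`2A/s² - A u²/(1 + i s u)`. The normalised integrand thus tends pointwise to `exp(-A u²)`, and
dominated convergence yields the Gaussian integral `√(π/A)`.

The dominating function `C/(1 + u²)` comes from two regimes. For `s|u| ≤ 8` the exact identity gives
Gaussian decay. For `s|u| ≥ 8` no modularity is used: an elementary comparison of `|1 - q^m|` with
`1 - |q|^m` over `m` not divisible by `ℓ` (`norm_regularGen_exp_neg_le`) saves a factor `exp(1/2 -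
1/(4s²))`, which beats every power of `s`. -/

/-! ### Euler's product and its modular transformation. -/

/-- Euler's product `∏_{n ≥ 1} (1 - q ^ n)`. -/
noncomputable def eulerProd (q : ℂ) : ℂ := ∏' n : ℕ, (1 - q ^ (n + 1))

theorem continuousOn_eulerProd : ContinuousOn eulerProd (Metric.ball 0 1) :=
  ModularForm.differentiableOn_tprod_one_sub_pow.continuousOn

theorem eulerProd_zero : eulerProd 0 = 1 := by simp [eulerProd]

theorem tendsto_eulerProd_zero : Tendsto eulerProd (nhds 0) (nhds 1) := by
  have h := (continuousOn_eulerProd.continuousAt (Metric.ball_mem_nhds 0 one_pos)).tendsto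
  rwa [eulerProd_zero] at h

theorem norm_exp_neg_lt_one {t : ℂ} (ht : 0 < t.re) : ‖Complex.exp (-t)‖ < 1 := by
  rw [Complex.norm_exp]
  simpa using ht

theorem one_sub_pow_succ_ne_zero {q : ℂ} (hq : ‖q‖ < 1) (n : ℕ) : 1 - q ^ (n + 1) ≠ 0 := by
  intro h
  have h1 : ‖q ^ (n + 1)‖ < 1 := by
    rw [norm_pow]
    exact pow_lt_one₀ (norm_nonneg _) hq (by omega)
  rw [← sub_eq_zero.mp h] at h1
  simp at h1

theorem eulerProd_ne_zero {q : ℂ} (hq : ‖q‖ < 1) : eulerProd q ≠ 0 := by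
  refine tprod_one_add_ne_zero_of_summable (f := fun n ↦ -q ^ (n + 1)) ?_ ?_
  · exact fun i ↦ by simpa [sub_eq_add_neg] using one_sub_pow_succ_ne_zero hq i
  · simpa using (summable_nat_add_iff 1).mpr (summable_geometric_of_lt_one (norm_nonneg _) hq)

/-- The modular transformation of Euler's product, in the variable `q = exp (-t)`. -/
theorem eulerProd_exp_neg {t : ℂ} (ht : 0 < t.re) :
    Complex.exp (-(Real.pi ^ 2 / 6) / t) * eulerProd (Complex.exp (-(4 * Real.pi ^ 2 / t))) =
      (Complex.sqrt Complex.I)⁻¹ * (Complex.sqrt (Complex.I * t / (2 * Real.pi)) *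
        (Complex.exp (-t / 24) * eulerProd (Complex.exp (-t)))) := by
  have ht0 : t ≠ 0 := fun h => by simp [h] at ht
  have hpi : (Real.pi : ℂ) ≠ 0 := by exact_mod_cast Real.pi_ne_zero
  -- With `τ = i t/(2π)` one has `exp(2πiτ) = exp(-t)`, and `τ ↦ -1/τ` becomes `t ↦ 4π²/t`.
  have hz : Complex.I * t / (2 * Real.pi) ∈ UpperHalfPlane.upperHalfPlaneSet := by
    have : (Complex.I * t / (2 * Real.pi)).im = t.re / (2 * Real.pi) := by
      rw [show (2 * Real.pi : ℂ) = ((2 * Real.pi : ℝ) : ℂ) by push_cast; ring,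
        Complex.div_ofReal_im]
      simp
    rw [UpperHalfPlane.upperHalfPlaneSet, Set.mem_ofPred_eq, this]
    have := Real.pi_pos
    positivity
  have h := ModularForm.eta_comp_eq_csqrt_I_inv hz
  simp only [Function.comp_apply, Pi.smul_apply, Pi.mul_apply, smul_eq_mul, ModularForm.eta,
    ModularForm.eta_q, Function.Periodic.qParam] at h
  have hI := Complex.I_sq
  have e1 : 2 * Real.pi * Complex.I * (-1 / (Complex.I * t / (2 * Real.pi))) / ((24 : ℝ) : ℂ) =
      -(Real.pi ^ 2 / 6) / t := by
    push_cast
    field_simp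
    ring
  have e2 : 2 * Real.pi * Complex.I * (-1 / (Complex.I * t / (2 * Real.pi))) / ((1 : ℝ) : ℂ) =
      -(4 * Real.pi ^ 2 / t) := by
    push_cast
    field_simp
    ring
  have e3 : 2 * Real.pi * Complex.I * (Complex.I * t / (2 * Real.pi)) / ((24 : ℝ) : ℂ) =
      -t / 24 := by
    push_cast
    field_simp
    linear_combination hI
  have e4 : 2 * Real.pi * Complex.I * (Complex.I * t / (2 * Real.pi)) / ((1 : ℝ) : ℂ) = -t := by
    push_cast
    field_simp
    linear_combination hI
  rw [e1, e2, e3, e4] at h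
  exact h

/-- The generating function of `ℓ`-regular partitions. -/
noncomputable def regularGen (ℓ : ℕ) (q : ℂ) : ℂ := eulerProd (q ^ ℓ) / eulerProd q

/-- Scaling by a positive real leaves the argument unchanged, so no branch problem arises. This lets
the square-root factors of the transformations at `t` and `ℓ t` cancel up to `√ℓ`. -/
theorem sqrt_natCast_mul {ℓ : ℕ} (hℓ : 0 < ℓ) (z : ℂ) :
    Complex.sqrt (ℓ * z) = (Real.sqrt ℓ : ℂ) * Complex.sqrt z := by
  by_cases hz : z = 0
  · simp [hz, Complex.sqrt]
  · have hl : (0 : ℝ) < ℓ := by exact_mod_cast hℓ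
    have h1 : (Real.sqrt ℓ : ℂ) = Complex.exp (2⁻¹ * (Real.log ℓ : ℂ)) := by
      rw [← Real.exp_log (Real.sqrt_pos.mpr hl), Real.log_sqrt hl.le]
      push_cast
      congr 1
      ring
    rw [sqrt_eq_exp (mul_ne_zero (by exact_mod_cast hℓ.ne') hz), sqrt_eq_exp hz,
      h1, ← Complex.exp_add, ← Complex.ofReal_natCast, Complex.log_ofReal_mul hl hz]
    congr 1
    push_cast
    ring

theorem re_ofReal_div (c : ℝ) (t : ℂ) : ((c : ℂ) / t).re = c * t.re / (t.re ^ 2 + t.im ^ 2) := by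
  rw [Complex.div_re, Complex.normSq_apply]
  simp only [Complex.ofReal_re, Complex.ofReal_im, zero_mul, zero_div, add_zero]
  ring

theorem re_ofReal_div_pos {c : ℝ} (hc : 0 < c) {t : ℂ} (ht : 0 < t.re) : 0 < ((c : ℂ) / t).re := by
  rw [re_ofReal_div]
  positivity

/-- Quotient of the transformation laws at `ℓ t` and `t`: the weight factors leave `ℓ^(-1/2)`, and
the exponentials combine. -/
theorem regularGen_exp_neg {ℓ : ℕ} (hℓ : 0 < ℓ) {t : ℂ} (ht : 0 < t.re) :
    regularGen ℓ (Complex.exp (-t)) =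
      (Real.sqrt ℓ : ℂ)⁻¹ * Complex.exp ((ℓ - 1) / 24 * t) *
        Complex.exp (Real.pi ^ 2 / 6 * (1 - 1 / ℓ) / t) *
        (eulerProd (Complex.exp (-(4 * Real.pi ^ 2 / (ℓ * t)))) /
          eulerProd (Complex.exp (-(4 * Real.pi ^ 2 / t)))) := by
  have hl : (ℓ : ℂ) ≠ 0 := by exact_mod_cast hℓ.ne'
  have hl' : (Real.sqrt ℓ : ℂ) ≠ 0 := by
    exact_mod_cast (Real.sqrt_pos.mpr (by exact_mod_cast hℓ)).ne'
  have ht0 : t ≠ 0 := fun h => by simp [h] at ht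
  have hpi : (Real.pi : ℂ) ≠ 0 := by exact_mod_cast Real.pi_ne_zero
  have htl : 0 < (ℓ * t).re := by
    simp only [Complex.mul_re, Complex.natCast_re, Complex.natCast_im, zero_mul, sub_zero]
    positivity
  have h1 := eulerProd_exp_neg ht
  have h2 := eulerProd_exp_neg htl
  have hinv : 0 < (4 * Real.pi ^ 2 / t).re := by
    have := re_ofReal_div_pos (c := 4 * Real.pi ^ 2) (by positivity) ht
    push_cast at this
    exact this
  have n1 := eulerProd_ne_zero (norm_exp_neg_lt_one ht)
  have n2 := eulerProd_ne_zero (norm_exp_neg_lt_one hinv)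
  -- Nonvanishing is read off the transformation law itself, whose left side is nonzero.
  have hs : Complex.sqrt (Complex.I * t / (2 * Real.pi)) ≠ 0 := by
    intro h
    rw [h] at h1
    simp [Complex.exp_ne_zero, n2] at h1
  have hsI : Complex.sqrt Complex.I ≠ 0 := by
    intro h
    rw [h] at h1
    simp [Complex.exp_ne_zero, n2] at h1
  rw [show Complex.I * (ℓ * t) / (2 * Real.pi) = ℓ * (Complex.I * t / (2 * Real.pi)) by ring,
    sqrt_natCast_mul hℓ] at h2
  rw [regularGen, ← Complex.exp_nat_mul, show (ℓ : ℂ) * -t = -(ℓ * t) by ring,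
    div_eq_iff n1]
  have x1 : Complex.exp ((ℓ - 1) / 24 * t) =
      Complex.exp (-t / 24) * (Complex.exp (-(ℓ * t) / 24))⁻¹ := by
    rw [← Complex.exp_neg, ← Complex.exp_add]; congr 1; ring
  have x2 : Complex.exp (Real.pi ^ 2 / 6 * (1 - 1 / ℓ) / t) =
      Complex.exp (-(Real.pi ^ 2 / 6) / (ℓ * t)) * (Complex.exp (-(Real.pi ^ 2 / 6) / t))⁻¹ := by
    rw [← Complex.exp_neg, ← Complex.exp_add]; congr 1; field_simp; ring
  rw [x1, x2]
  have y1 := Complex.exp_ne_zero (-(ℓ * t) / 24)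
  have y2 := Complex.exp_ne_zero (-(Real.pi ^ 2 / 6) / t)
  have y3 := Complex.exp_ne_zero (-t / 24)
  generalize Complex.exp (-(ℓ * t) / 24) = a1 at *
  generalize Complex.exp (-(Real.pi ^ 2 / 6) / t) = a2 at *
  generalize Complex.exp (-t / 24) = a3 at *
  generalize Complex.exp (-(Real.pi ^ 2 / 6) / (ℓ * t)) = a4 at *
  generalize Complex.sqrt (Complex.I * t / (2 * Real.pi)) = a5 at *
  generalize Complex.sqrt Complex.I = a6 at *
  generalize (Real.sqrt ℓ : ℂ) = a7 at *
  generalize eulerProd (Complex.exp (-(4 * Real.pi ^ 2 / (ℓ * t)))) = c1 at *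
  generalize eulerProd (Complex.exp (-(4 * Real.pi ^ 2 / t))) = c2 at *
  generalize eulerProd (Complex.exp (-t)) = c3 at *
  generalize eulerProd (Complex.exp (-(ℓ * t))) = c4 at *
  have k1 : c3 = a2 * c2 * a6 / (a5 * a3) := by
    field_simp
    rw [h1]
    field_simp
  have k2 : c4 = a4 * c1 * a6 / (a7 * a5 * a1) := by
    field_simp
    rw [h2]
    field_simp
  rw [k1, k2]
  field_simp

/-! ### The generating function as a convergent power series. -/

/-- The generating polynomial of partitions into parts at most `N`, each repeated fewer than `ℓ`
times. -/
noncomputable def countRestrictedPoly (ℓ N : ℕ) : Polynomial ℝ :=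
  ∏ i ∈ Finset.range N, ∑ j ∈ Finset.range ℓ, Polynomial.X ^ ((i + 1) * j)

theorem coeff_countRestrictedPoly_nonneg (ℓ N n : ℕ) : 0 ≤ (countRestrictedPoly ℓ N).coeff n := by
  induction N generalizing n with
  | zero =>
    simp only [countRestrictedPoly, Finset.range_zero, Finset.prod_empty, Polynomial.coeff_one]
    split_ifs <;> simp
  | succ N ih =>
    rw [countRestrictedPoly, Finset.prod_range_succ, ← countRestrictedPoly, Polynomial.coeff_mul]
    refine Finset.sum_nonneg fun p _ => mul_nonneg (ih _) ?_
    rw [Polynomial.finsetSum_coeff]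
    refine Finset.sum_nonneg fun j _ => ?_
    rw [Polynomial.coeff_X_pow]
    split_ifs <;> simp

/-- Each new factor is `1` plus a polynomial with nonnegative coefficients. -/
theorem monotone_coeff_countRestrictedPoly {ℓ : ℕ} (hℓ : 0 < ℓ) (n : ℕ) :
    Monotone fun N => (countRestrictedPoly ℓ N).coeff n := by
  refine monotone_nat_of_le_succ fun N => ?_
  obtain ⟨k, rfl⟩ : ∃ k, ℓ = k + 1 := ⟨ℓ - 1, by omega⟩
  rw [countRestrictedPoly, countRestrictedPoly, Finset.prod_range_succ, ← countRestrictedPoly,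
    Finset.sum_range_succ', mul_zero, pow_zero, mul_add, mul_one, Polynomial.coeff_add,
    Polynomial.coeff_mul]
  refine le_add_of_nonneg_left (Finset.sum_nonneg fun p _ =>
    mul_nonneg (coeff_countRestrictedPoly_nonneg _ _ _) ?_)
  rw [Polynomial.finsetSum_coeff]
  refine Finset.sum_nonneg fun j _ => ?_
  rw [Polynomial.coeff_X_pow]
  split_ifs <;> simp

open PowerSeries.WithPiTopology in
-- Glaisher's theorem replaces "no part divisible by `ℓ`" by "no part repeated `ℓ` times". The
-- latter has polynomial partial products with nonnegative coefficients, which is what the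
-- convergence arguments need.
theorem tendsto_coeff_countRestrictedPoly {ℓ : ℕ} (hℓ : 0 < ℓ) (n : ℕ) :
    Tendsto (fun N => (countRestrictedPoly ℓ N).coeff n) atTop
      (nhds ((Nat.Partition.restricted n (fun a => ¬ ℓ ∣ a)).card : ℝ)) := by
  have h := (Nat.Partition.hasProd_powerSeriesMk_card_countRestricted ℝ hℓ).tendsto_prod_nat
  rw [tendsto_iff_coeff_tendsto] at h
  have h := h n
  rw [PowerSeries.coeff_mk, ← Nat.Partition.card_restricted_eq_card_countRestricted n hℓ] at h
  refine h.congr fun N => ?_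
  rw [← Polynomial.coeff_coe, countRestrictedPoly]
  congr 1
  rw [← Polynomial.coeToPowerSeries.ringHom_apply, map_prod]
  refine Finset.prod_congr rfl fun i _ => ?_
  rw [map_sum]
  refine Finset.sum_congr rfl fun j _ => ?_
  rw [map_pow, Polynomial.coeToPowerSeries.ringHom_apply, Polynomial.coe_X]

theorem norm_pow_lt_one {q : ℂ} (hq : ‖q‖ < 1) {ℓ : ℕ} (hℓ : 0 < ℓ) : ‖q ^ ℓ‖ < 1 := by
  rw [norm_pow]
  exact pow_lt_one₀ (norm_nonneg _) hq hℓ.ne'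

theorem tendsto_aeval_countRestrictedPoly {ℓ : ℕ} (hℓ : 0 < ℓ) {q : ℂ} (hq : ‖q‖ < 1) :
    Tendsto (fun N => Polynomial.aeval q (countRestrictedPoly ℓ N)) atTop
      (nhds (regularGen ℓ q)) := by
  have h1 := (ModularForm.multipliable_one_sub_pow hq).tendsto_prod_tprod_nat
  have h2 := (ModularForm.multipliable_one_sub_pow (norm_pow_lt_one hq hℓ)).tendsto_prod_tprod_nat
  refine (h2.div h1 (eulerProd_ne_zero hq)).congr fun N => ?_
  rw [Pi.div_apply, countRestrictedPoly, map_prod, ← Finset.prod_div_distrib]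
  refine Finset.prod_congr rfl fun i _ => ?_
  rw [div_eq_iff (one_sub_pow_succ_ne_zero hq i), map_sum, ← pow_mul, mul_comm ℓ, pow_mul,
    ← geom_sum_mul_neg]
  simp [pow_mul]

/-- A finite partial sum is a limit of partial sums of the polynomials at `x`; by nonnegativity
these are at most the polynomial values, which converge and so are bounded. -/
theorem summable_card_restricted {ℓ : ℕ} (hℓ : 0 < ℓ) {x : ℝ} (hx : 0 ≤ x) (hx1 : x < 1) :
    Summable fun n => ((Nat.Partition.restricted n (fun a => ¬ ℓ ∣ a)).card : ℝ) * x ^ n := by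
  have hxn : ‖(x : ℂ)‖ < 1 := by simpa [abs_of_nonneg hx] using hx1
  obtain ⟨C, hC⟩ := (tendsto_aeval_countRestrictedPoly hℓ hxn).norm.bddAbove_range
  refine summable_of_sum_le (c := C) (fun n => by positivity) fun s => ?_
  refine le_of_tendsto (tendsto_finsetSum s fun n _ =>
    (tendsto_coeff_countRestrictedPoly hℓ n).mul_const (x ^ n)) (Eventually.of_forall fun N => ?_)
  refine le_trans ?_ (hC ⟨N, rfl⟩)
  have h0 : Polynomial.aeval (x : ℂ) (countRestrictedPoly ℓ N) =
      (((countRestrictedPoly ℓ N).eval x : ℝ) : ℂ) := by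
    rw [← Complex.coe_algebraMap, Polynomial.aeval_algebraMap_apply]
    simp
  simp only [h0]
  rw [Complex.norm_real]
  refine le_trans ?_ (Real.le_norm_self _)
  rw [Polynomial.eval_eq_sum]
  rw [Polynomial.sum]
  have hnn : ∀ n, 0 ≤ (countRestrictedPoly ℓ N).coeff n * x ^ n := fun n =>
    mul_nonneg (coeff_countRestrictedPoly_nonneg _ _ _) (by positivity)
  calc ∑ n ∈ s, (countRestrictedPoly ℓ N).coeff n * x ^ n
      ≤ ∑ n ∈ s ∪ (countRestrictedPoly ℓ N).support, (countRestrictedPoly ℓ N).coeff n * x ^ n :=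
        Finset.sum_le_sum_of_subset_of_nonneg Finset.subset_union_left fun n _ _ => hnn n
    _ = ∑ n ∈ (countRestrictedPoly ℓ N).support, (countRestrictedPoly ℓ N).coeff n * x ^ n := by
        refine (Finset.sum_subset Finset.subset_union_right fun n _ hn => ?_).symm
        rw [Polynomial.notMem_support_iff.mp hn, zero_mul]

theorem tsum_card_restricted {ℓ : ℕ} (hℓ : 0 < ℓ) {q : ℂ} (hq : ‖q‖ < 1) :
    ∑' n, ((Nat.Partition.restricted n (fun a => ¬ ℓ ∣ a)).card : ℂ) * q ^ n =
      regularGen ℓ q := by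
  refine tendsto_nhds_unique ?_ (tendsto_aeval_countRestrictedPoly hℓ hq)
  -- By monotonicity in `N` the limiting coefficients dominate those of every polynomial.
  have h := tendsto_tsum_of_dominated_convergence (𝓕 := atTop)
    (f := fun N n => ((countRestrictedPoly ℓ N).coeff n : ℂ) * q ^ n)
    (summable_card_restricted hℓ (norm_nonneg q) hq)
    (fun n => ((Complex.continuous_ofReal.tendsto _).comp
      (tendsto_coeff_countRestrictedPoly hℓ n)).mul_const (q ^ n))
    (Eventually.of_forall fun N n => by
      rw [norm_mul, norm_pow, Complex.norm_real,
        Real.norm_of_nonneg (coeff_countRestrictedPoly_nonneg _ _ _)]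
      gcongr
      exact (monotone_coeff_countRestrictedPoly hℓ n).ge_of_tendsto
        (tendsto_coeff_countRestrictedPoly hℓ n) N)
  simp only [Complex.ofReal_natCast] at h
  refine h.congr fun N => ?_
  rw [Polynomial.aeval_eq_sum_range, tsum_eq_sum (s := Finset.range
    ((countRestrictedPoly ℓ N).natDegree + 1))]
  · simp
  · intro n hn
    rw [Polynomial.coeff_eq_zero_of_natDegree_lt (by simpa using hn)]
    simp

theorem summable_and_tsum_coeff_pow (f : PowerSeries ℂ) (q : ℂ)
    (hf : Summable fun n => ‖f.coeff n * q ^ n‖) (r : ℕ) :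
    (Summable fun n => ‖(f ^ r).coeff n * q ^ n‖) ∧
      ∑' n, (f ^ r).coeff n * q ^ n = (∑' n, f.coeff n * q ^ n) ^ r := by
  induction r with
  | zero =>
    have h : ∀ n ∉ ({0} : Finset ℕ), (PowerSeries.coeff n (1 : PowerSeries ℂ)) * q ^ n = 0 := by
      intro n hn
      rw [PowerSeries.coeff_one, if_neg (by simpa using hn), zero_mul]
    simp only [pow_zero]
    refine ⟨(hasSum_sum_of_ne_finset_zero fun n hn => by rw [h n hn, norm_zero]).summable, ?_⟩
    rw [tsum_eq_sum h]
    simp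
  | succ r ih =>
    have hmul : ∀ n, (f ^ (r + 1)).coeff n * q ^ n = ∑ kl ∈ Finset.HasAntidiagonal.antidiagonal n,
        ((f ^ r).coeff kl.1 * q ^ kl.1) * (f.coeff kl.2 * q ^ kl.2) := by
      intro n
      rw [pow_succ, PowerSeries.coeff_mul, Finset.sum_mul]
      refine Finset.sum_congr rfl fun p hp => ?_
      rw [← Finset.HasAntidiagonal.mem_antidiagonal.mp hp, pow_add]
      ring
    have h1 := summable_norm_sum_mul_antidiagonal_of_summable_norm
      (f := fun n => (f ^ r).coeff n * q ^ n) (g := fun n => f.coeff n * q ^ n) ih.1 hf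
    have h2 := tsum_mul_tsum_eq_tsum_sum_antidiagonal_of_summable_norm
      (f := fun n => (f ^ r).coeff n * q ^ n) (g := fun n => f.coeff n * q ^ n) ih.1 hf
    refine ⟨h1.congr fun n => by rw [hmul], ?_⟩
    rw [tsum_congr hmul, pow_succ, ← ih.2]
    exact h2.symm

theorem summable_and_tsum_coloredRegularCount (r : ℕ) {ℓ : ℕ} (hℓ : 0 < ℓ) {q : ℂ}
    (hq : ‖q‖ < 1) :
    (Summable fun n => ‖(coloredRegularCount r ℓ n : ℂ) * q ^ n‖) ∧
      ∑' n, (coloredRegularCount r ℓ n : ℂ) * q ^ n = regularGen ℓ q ^ r := by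
  have h := congrArg (PowerSeries.map (Int.castRingHom ℂ)) (mk_coloredRegularCount r ℓ)
  rw [map_pow] at h
  have hs : Summable fun n => ‖(PowerSeries.map (Int.castRingHom ℂ) (PowerSeries.mk fun n =>
      ((Nat.Partition.restricted n (fun a => ¬ ℓ ∣ a)).card : ℤ))).coeff n * q ^ n‖ := by
    simpa using summable_card_restricted hℓ (norm_nonneg q) hq
  have h2 := summable_and_tsum_coeff_pow _ q hs r
  rw [← h] at h2
  simp only [PowerSeries.coeff_map, PowerSeries.coeff_mk, Int.coe_castRingHom,
    Int.cast_natCast] at h2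
  rwa [tsum_card_restricted hℓ hq] at h2

/-! ### Cauchy's coefficient formula. -/

theorem integral_exp_int_mul_I {k : ℤ} (hk : k ≠ 0) :
    ∫ y in -Real.pi..Real.pi, Complex.exp (k * Complex.I * (y : ℂ)) = 0 := by
  have hc : (k * Complex.I : ℂ) ≠ 0 := mul_ne_zero (by exact_mod_cast hk) Complex.I_ne_zero
  rw [integral_exp_mul_complex hc, div_eq_zero_iff]
  left
  rw [sub_eq_zero, Complex.exp_eq_exp_iff_exists_int]
  exact ⟨k, by push_cast; ring⟩

/-- Cauchy's formula for the number of coloured regular partitions, on the circle of radius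
`exp (-x)`. -/
theorem integral_regularGen_pow (r : ℕ) {ℓ : ℕ} (hℓ : 0 < ℓ) (n : ℕ) {x : ℝ} (hx : 0 < x) :
    ∫ y in -Real.pi..Real.pi, regularGen ℓ (Complex.exp (-(x + y * Complex.I))) ^ r *
        Complex.exp (n * (x + y * Complex.I)) =
      2 * Real.pi * coloredRegularCount r ℓ n := by
  have hq : ∀ y : ℝ, ‖Complex.exp (-(x + y * Complex.I))‖ < 1 := fun y =>
    norm_exp_neg_lt_one (by simpa using hx)
  have hnorm : ∀ y : ℝ, ‖Complex.exp (-(x + y * Complex.I))‖ = Real.exp (-x) := fun y => by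
    simp [Complex.norm_exp]
  have hsum : Summable fun m => (coloredRegularCount r ℓ m : ℝ) * Real.exp (-x) ^ m *
      Real.exp (n * x) := by
    have := (summable_and_tsum_coloredRegularCount r hℓ (hq 0)).1
    simp only [norm_mul, norm_pow, hnorm, Complex.norm_natCast] at this
    exact this.mul_right _
  have h := intervalIntegral.hasSum_integral_of_dominated_convergence
    (μ := MeasureTheory.volume) (a := -Real.pi) (b := Real.pi)
    (F := fun (m : ℕ) (y : ℝ) => (coloredRegularCount r ℓ m : ℂ) *
      Complex.exp (-(x + y * Complex.I)) ^ m * Complex.exp (n * (x + y * Complex.I)))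
    (f := fun y : ℝ => regularGen ℓ (Complex.exp (-(x + y * Complex.I))) ^ r *
        Complex.exp (n * (x + y * Complex.I)))
    (fun m _ => (coloredRegularCount r ℓ m : ℝ) * Real.exp (-x) ^ m * Real.exp (n * x))
    (fun m => Continuous.aestronglyMeasurable (by fun_prop))
    (fun m => Eventually.of_forall fun y _ => by
      rw [norm_mul, norm_mul, norm_pow, hnorm, Complex.norm_natCast, Complex.norm_exp]
      simp)
    (Eventually.of_forall fun y _ => hsum)
    intervalIntegrable_const
    (Eventually.of_forall fun y _ => by
      have h1 := summable_and_tsum_coloredRegularCount r hℓ (hq y)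
      have h2 := h1.1.of_norm.hasSum
      rw [h1.2] at h2
      exact h2.mul_right _)
  have hterm : ∀ m : ℕ, (∫ y in -Real.pi..Real.pi, (coloredRegularCount r ℓ m : ℂ) *
      Complex.exp (-(x + y * Complex.I)) ^ m * Complex.exp (n * (x + y * Complex.I))) =
      if m = n then 2 * Real.pi * (coloredRegularCount r ℓ n : ℂ) else 0 := by
    intro m
    have he : ∀ y : ℝ, (coloredRegularCount r ℓ m : ℂ) *
        Complex.exp (-(x + y * Complex.I)) ^ m * Complex.exp (n * (x + y * Complex.I)) =
        (coloredRegularCount r ℓ m : ℂ) * Complex.exp ((n - m) * x) *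
          Complex.exp (((n : ℤ) - (m : ℤ) : ℤ) * Complex.I * y) := by
      intro y
      rw [← Complex.exp_nat_mul, mul_assoc, mul_assoc, ← Complex.exp_add, ← Complex.exp_add]
      congr 2
      push_cast
      ring
    simp only [he]
    rw [intervalIntegral.integral_const_mul]
    split_ifs with hmn
    · subst hmn
      simp
      ring
    · rw [integral_exp_int_mul_I (by omega), mul_zero]
  simp only [hterm] at h
  exact h.unique (hasSum_ite_eq n _)

/-! ### Bounds away from the positive real axis. -/

/-- In `log|1 - w| - log(1 - |w|) = ∑ (|w|^k - Re w^k)/k` every term is nonnegative; keep only `k =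
1`. -/
theorem one_sub_norm_mul_exp_le {w : ℂ} (hw : ‖w‖ < 1) :
    (1 - ‖w‖) * Real.exp (‖w‖ - w.re) ≤ ‖1 - w‖ := by
  have hw1 : 1 - w ≠ 0 := by
    intro h
    rw [← sub_eq_zero.mp h] at hw
    simp at hw
  have hn : ‖((‖w‖ : ℝ) : ℂ)‖ < 1 := by simpa using hw
  have h1 := Complex.hasSum_re (Complex.hasSum_taylorSeries_neg_log hw)
  have h2 := Complex.hasSum_re (Complex.hasSum_taylorSeries_neg_log hn)
  have h3 := le_hasSum (h2.sub h1) 1 fun n _ => by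
    rw [← Complex.ofReal_pow, Complex.div_natCast_re, Complex.div_natCast_re, Complex.ofReal_re,
      ← sub_div, ← norm_pow]
    exact div_nonneg (sub_nonneg.mpr (Complex.re_le_norm _)) (Nat.cast_nonneg _)
  simp only [pow_one, Nat.cast_one, div_one, Complex.ofReal_re, Complex.neg_re, Complex.log_re]
    at h3
  rw [← Complex.ofReal_one, ← Complex.ofReal_sub, Complex.norm_real,
    Real.norm_of_nonneg (sub_nonneg.mpr hw.le), Complex.ofReal_one] at h3
  have h4 : 0 < 1 - ‖w‖ := sub_pos.mpr hw
  calc (1 - ‖w‖) * Real.exp (‖w‖ - w.re)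
      ≤ (1 - ‖w‖) * Real.exp (Real.log ‖1 - w‖ - Real.log (1 - ‖w‖)) := by
        exact mul_le_mul_of_nonneg_left (Real.exp_le_exp.mpr (by linarith)) h4.le
    _ = ‖1 - w‖ := by
        rw [Real.exp_sub, Real.exp_log (norm_pos_iff.mpr hw1), Real.exp_log h4]
        field_simp

/-- Products and sums over exponents `m + 1` start at `m = 0`; this map enumerates the `m` with `ℓ ∣
m + 1`. -/
theorem mul_succ_sub_one_injective {ℓ : ℕ} (hℓ : 0 < ℓ) :
    Function.Injective fun k : ℕ => (k + 1) * ℓ - 1 := by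
  intro a b h
  have ha : 0 < (a + 1) * ℓ := by positivity
  have hb : 0 < (b + 1) * ℓ := by positivity
  have : (a + 1) * ℓ = (b + 1) * ℓ := by simp only at h; omega
  have := Nat.eq_of_mul_eq_mul_right hℓ this
  omega

theorem mem_range_mul_succ_sub_one {ℓ m : ℕ} (h : ℓ ∣ m + 1) :
    m ∈ Set.range fun k : ℕ => (k + 1) * ℓ - 1 := by
  obtain ⟨c, hc⟩ := h
  have hc0 : 0 < c := Nat.pos_of_ne_zero (by rintro rfl; simp at hc)
  exact ⟨c - 1, by simp only [Nat.sub_add_cancel hc0]; rw [mul_comm]; omega⟩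

theorem multipliable_one_sub_pow_of_not_dvd (ℓ : ℕ) {q : ℂ} (hq : ‖q‖ < 1) :
    Multipliable fun m : ℕ => if ℓ ∣ m + 1 then 1 else 1 - q ^ (m + 1) := by
  have h : (fun m : ℕ => if ℓ ∣ m + 1 then 1 else 1 - q ^ (m + 1)) =
      fun m => 1 + (if ℓ ∣ m + 1 then 0 else -q ^ (m + 1)) := by
    funext m
    split_ifs <;> ring
  rw [h]
  refine multipliable_one_add_of_summable (Summable.of_nonneg_of_le (fun _ => norm_nonneg _)
    (fun m => ?_) ((summable_nat_add_iff 1).mpr (summable_geometric_of_lt_one (norm_nonneg q) hq)))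
  split_ifs
  · simp
  · simp

/-- The factors with exponent divisible by `ℓ` form Euler's product at `q^ℓ`. Hence `1 / regularGen
ℓ q` is the product over the remaining exponents, to which the factorwise bound applies. -/
theorem eulerProd_pow_mul_tprod {ℓ : ℕ} (hℓ : 0 < ℓ) {q : ℂ} (hq : ‖q‖ < 1) :
    eulerProd (q ^ ℓ) * (∏' m : ℕ, if ℓ ∣ m + 1 then 1 else 1 - q ^ (m + 1)) = eulerProd q := by
  have h1 : HasProd (fun m : ℕ => if ℓ ∣ m + 1 then 1 - q ^ (m + 1) else 1)
      (eulerProd (q ^ ℓ)) := by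
    rw [← (mul_succ_sub_one_injective hℓ).hasProd_iff]
    · have h : HasProd (fun k : ℕ => 1 - (q ^ ℓ) ^ (k + 1)) (eulerProd (q ^ ℓ)) :=
        (ModularForm.multipliable_one_sub_pow (norm_pow_lt_one hq hℓ)).hasProd
      convert h using 2
      rename_i k
      have : 0 < (k + 1) * ℓ := by positivity
      simp only [Function.comp_apply, Nat.sub_add_cancel this, dvd_mul_left, if_true]
      rw [← pow_mul, mul_comm]
    · intro m hm
      exact if_neg fun h => hm (mem_range_mul_succ_sub_one h)
  rw [← (h1.mul (multipliable_one_sub_pow_of_not_dvd ℓ hq).hasProd).tprod_eq, eulerProd]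
  refine tprod_congr fun m => ?_
  split_ifs <;> simp

theorem hasSum_pow_of_not_dvd {ℓ : ℕ} (hℓ : 0 < ℓ) {q : ℂ} (hq : ‖q‖ < 1) :
    HasSum (fun m : ℕ => if ℓ ∣ m + 1 then 0 else q ^ (m + 1)) ((1 - q)⁻¹ - (1 - q ^ ℓ)⁻¹) := by
  have hgeo : ∀ w : ℂ, ‖w‖ < 1 → HasSum (fun m : ℕ => w ^ (m + 1)) ((1 - w)⁻¹ - 1) := fun w hw => by
    have h := (hasSum_nat_add_iff' (f := fun m : ℕ => w ^ m) 1).mpr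
      (hasSum_geometric_of_norm_lt_one hw)
    rwa [Finset.sum_range_one, pow_zero] at h
  have h1 : HasSum (fun m : ℕ => if ℓ ∣ m + 1 then q ^ (m + 1) else 0) ((1 - q ^ ℓ)⁻¹ - 1) := by
    rw [← (mul_succ_sub_one_injective hℓ).hasSum_iff]
    · convert hgeo _ (norm_pow_lt_one hq hℓ) using 2
      rename_i k
      have : 0 < (k + 1) * ℓ := by positivity
      simp only [Function.comp_apply, Nat.sub_add_cancel this, dvd_mul_left, if_true]
      rw [← pow_mul, mul_comm]
    · intro m hm
      exact if_neg fun h => hm (mem_range_mul_succ_sub_one h)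
  have h2 := (hgeo q hq).sub h1
  rw [sub_sub_sub_cancel_right] at h2
  have e : (fun m : ℕ => if ℓ ∣ m + 1 then 0 else q ^ (m + 1)) =
      fun m => q ^ (m + 1) - if ℓ ∣ m + 1 then q ^ (m + 1) else 0 := by
    funext m
    split_ifs <;> simp
  rw [e]
  exact h2

/-- Moving off the positive real axis decreases the generating function of regular partitions. -/
theorem norm_regularGen_mul_exp_le {ℓ : ℕ} (hℓ : 0 < ℓ) {q : ℂ} (hq : ‖q‖ < 1) :
    ‖regularGen ℓ q‖ * Real.exp (((1 - (‖q‖ : ℂ))⁻¹ - (1 - (‖q‖ : ℂ) ^ ℓ)⁻¹).re -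
      ((1 - q)⁻¹ - (1 - q ^ ℓ)⁻¹).re) ≤ ‖regularGen ℓ (‖q‖ : ℂ)‖ := by
  have hn : ‖((‖q‖ : ℝ) : ℂ)‖ < 1 := by simpa using hq
  have hgen : ∀ w : ℂ, ‖w‖ < 1 → regularGen ℓ w *
      (∏' m : ℕ, if ℓ ∣ m + 1 then 1 else 1 - w ^ (m + 1)) = 1 := fun w hw => by
    have h1 := eulerProd_ne_zero hw
    rw [regularGen, div_mul_eq_mul_div, eulerProd_pow_mul_tprod hℓ hw, div_self h1]
  have hS := (Complex.hasSum_re (hasSum_pow_of_not_dvd hℓ hn)).sub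
    (Complex.hasSum_re (hasSum_pow_of_not_dvd hℓ hq))
  have hle : ‖∏' m : ℕ, if ℓ ∣ m + 1 then 1 else 1 - (‖q‖ : ℂ) ^ (m + 1)‖ *
      Real.exp (((1 - (‖q‖ : ℂ))⁻¹ - (1 - (‖q‖ : ℂ) ^ ℓ)⁻¹).re -
        ((1 - q)⁻¹ - (1 - q ^ ℓ)⁻¹).re) ≤
      ‖∏' m : ℕ, if ℓ ∣ m + 1 then 1 else 1 - q ^ (m + 1)‖ := by
    -- The inequality holds factor by factor for finite products; the exponents sum to the
    -- difference of the two restricted geometric series.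
    refine le_of_tendsto_of_tendsto'
      ((multipliable_one_sub_pow_of_not_dvd ℓ hn).tendsto_prod_tprod_nat.norm.mul
        ((Real.continuous_exp.tendsto _).comp hS.tendsto_sum_nat))
      (multipliable_one_sub_pow_of_not_dvd ℓ hq).tendsto_prod_tprod_nat.norm fun N => ?_
    simp only [Function.comp_apply]
    rw [Real.exp_sum, norm_prod, norm_prod, ← Finset.prod_mul_distrib]
    refine Finset.prod_le_prod (fun m _ => by positivity) fun m _ => ?_
    split_ifs
    · simp
    · have h := one_sub_norm_mul_exp_le (w := q ^ (m + 1))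
        (norm_pow_lt_one hq (Nat.succ_pos m))
      have h0 : 0 ≤ 1 - ‖q‖ ^ (m + 1) := sub_nonneg.mpr (pow_le_one₀ (norm_nonneg _) hq.le)
      rw [norm_pow] at h
      rwa [← Complex.ofReal_pow, Complex.ofReal_re, ← Complex.ofReal_one, ← Complex.ofReal_sub,
        Complex.norm_real, Real.norm_of_nonneg h0, Complex.ofReal_one]
  have e1 := congrArg norm (hgen q hq)
  have e2 := congrArg norm (hgen _ hn)
  rw [norm_mul, norm_one] at e1 e2
  have p2 : 0 < ‖∏' m : ℕ, if ℓ ∣ m + 1 then 1 else 1 - (‖q‖ : ℂ) ^ (m + 1)‖ :=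
    lt_of_le_of_ne (norm_nonneg _) fun h => by rw [← h] at e2; simp at e2
  have h3 := mul_le_mul_of_nonneg_left hle (norm_nonneg (regularGen ℓ q))
  rw [e1] at h3
  refine le_of_mul_le_mul_right ?_ p2
  rw [e2]
  linarith

/-- The map `w ↦ 1/(1 - w)` sends the unit disc to the half-plane `Re > 1/2`. -/
theorem half_le_re_inv_one_sub {w : ℂ} (hw : ‖w‖ < 1) : 1 / 2 ≤ ((1 - w)⁻¹).re := by
  have h1 : w.re ^ 2 + w.im ^ 2 < 1 := by
    rw [← Complex.sq_norm_sub_sq_re w]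
    nlinarith [norm_nonneg w]
  have h2 : 0 < (1 - w.re) * (1 - w.re) + w.im * w.im := by nlinarith [sq_nonneg (1 - w.re)]
  rw [Complex.inv_re, Complex.normSq_apply]
  simp only [Complex.sub_re, Complex.one_re, Complex.sub_im, Complex.one_im, zero_sub,
    neg_mul_neg]
  rw [div_le_div_iff₀ (by norm_num) h2]
  nlinarith

/-- The squared modulus equals `(1 - e^(-x))² + 2e^(-x)(1 - cos y)`; drop the first square and use
`cos y ≤ 1 - 2y²/π²`. -/
theorem sq_norm_one_sub_exp_neg_ge {x y : ℝ} (hy : |y| ≤ Real.pi) :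
    Real.exp (-x) * (4 / Real.pi ^ 2 * y ^ 2) ≤
      ‖1 - Complex.exp (-(x + y * Complex.I))‖ ^ 2 := by
  have h1 := Real.cos_le_one_sub_mul_cos_sq hy
  rw [Complex.sq_norm, Complex.normSq_apply]
  simp only [Complex.sub_re, Complex.one_re, Complex.sub_im, Complex.one_im, Complex.exp_re,
    Complex.exp_im, Complex.neg_re, Complex.neg_im, Complex.add_re, Complex.add_im,
    Complex.ofReal_re, Complex.ofReal_im, Complex.re_ofReal_mul, Complex.im_ofReal_mul,
    Complex.I_re, Complex.I_im, mul_zero, mul_one, add_zero, zero_add, Real.cos_neg, Real.sin_neg]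
  have h2 := Real.sin_sq_add_cos_sq y
  have h3 := Real.exp_pos (-x)
  have h4 := mul_le_mul_of_nonneg_left h1 h3.le
  have h5 : (1 - Real.exp (-x) * Real.cos y) * (1 - Real.exp (-x) * Real.cos y) +
      (0 - Real.exp (-x) * -Real.sin y) * (0 - Real.exp (-x) * -Real.sin y) =
      1 - 2 * (Real.exp (-x) * Real.cos y) + Real.exp (-x) ^ 2 := by
    linear_combination Real.exp (-x) ^ 2 * h2
  have h6 : Real.exp (-x) * (4 / Real.pi ^ 2 * y ^ 2) =
      2 * (Real.exp (-x) - Real.exp (-x) * (1 - 2 / Real.pi ^ 2 * y ^ 2)) := by ring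
  rw [h5, h6]
  linarith [sq_nonneg (1 - Real.exp (-x))]

/-- Away from the positive real axis the generating function of regular partitions is
exponentially smaller than on it. -/
theorem norm_regularGen_exp_neg_le {ℓ : ℕ} (hℓ : 2 ≤ ℓ) {x y : ℝ} (hx : 0 < x) (hx1 : x ≤ 1 / 4)
    (hxy : 8 * x ≤ |y|) (hy : |y| ≤ Real.pi) :
    ‖regularGen ℓ (Complex.exp (-(x + y * Complex.I)))‖ ≤
      ‖regularGen ℓ (Complex.exp (-x))‖ * Real.exp (1 / 2 - 1 / (4 * x)) := by
  have hq := norm_exp_neg_lt_one (t := x + y * Complex.I) (by simpa using hx)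
  have hnorm : ((‖Complex.exp (-(x + y * Complex.I))‖ : ℝ) : ℂ) = Complex.exp (-x) := by
    rw [Complex.norm_exp]
    simp
  have h := norm_regularGen_mul_exp_le (by omega : 0 < ℓ) hq
  rw [hnorm] at h
  set q := Complex.exp (-(x + y * Complex.I)) with hqdef
  have hl : (2 : ℝ) ≤ ℓ := by exact_mod_cast hℓ
  have b1 : ((1 - q)⁻¹ - (1 - q ^ ℓ)⁻¹).re ≤ 1 / (4 * x) - 1 / 2 := by
    rw [Complex.sub_re]
    have := half_le_re_inv_one_sub (norm_pow_lt_one hq (by omega : 0 < ℓ))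
    have h2 : ((1 - q)⁻¹).re ≤ 1 / (4 * x) := by
      refine (Complex.re_le_norm _).trans ?_
      rw [norm_inv, ← one_div]
      refine one_div_le_one_div_of_le (by positivity) ?_
      refine le_of_sq_le_sq ?_ (norm_nonneg _)
      refine le_trans ?_ (sq_norm_one_sub_exp_neg_ge hy)
      -- With `π² ≤ 12` the constants fit: `(3/4)(1/3)(8x)² = (4x)²`.
      have e1 : 3 / 4 ≤ Real.exp (-x) := by linarith [Real.add_one_le_exp (-x)]
      have e2 : (8 * x) ^ 2 ≤ y ^ 2 := by
        rw [← sq_abs y]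
        gcongr
      have e3 : 1 / 3 ≤ 4 / Real.pi ^ 2 := by
        rw [div_le_div_iff₀ (by norm_num) (by positivity)]
        nlinarith [Real.pi_lt_d2, Real.pi_pos]
      calc (4 * x) ^ 2 = 3 / 4 * (1 / 3 * (8 * x) ^ 2) := by ring
        _ ≤ Real.exp (-x) * (4 / Real.pi ^ 2 * y ^ 2) := by gcongr
    linarith
  -- On the real axis the series is at least `1/x - 1 - 1/(ℓx)`, and `ℓ ≥ 2` makes this at least
  -- `1/(2x) - 1`. Subtracting the bound `1/(4x) - 1/2` off the axis leaves the gain `1/(4x) - 1/2`.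
  have b2 : 1 / (2 * x) - 1 ≤ ((1 - Complex.exp (-x))⁻¹ - (1 - Complex.exp (-x) ^ ℓ)⁻¹).re := by
    have e : ((1 - Complex.exp (-x))⁻¹ - (1 - Complex.exp (-x) ^ ℓ)⁻¹) =
        (((1 - Real.exp (-x))⁻¹ - (1 - Real.exp (-(ℓ * x)))⁻¹ : ℝ) : ℂ) := by
      rw [← Complex.exp_nat_mul]
      push_cast
      rw [mul_neg]
    rw [e, Complex.ofReal_re]
    have f1 : 1 / x ≤ (1 - Real.exp (-x))⁻¹ := by
      rw [← one_div]
      refine one_div_le_one_div_of_le ?_ (by linarith [Real.add_one_le_exp (-x)])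
      simpa using hx
    have hu : 0 < ℓ * x := by positivity
    have f2 : (1 - Real.exp (-(ℓ * x)))⁻¹ ≤ 1 + 1 / (ℓ * x) := by
      have g1 := Real.add_one_le_exp (ℓ * x)
      have g2 : Real.exp (-(ℓ * x)) ≤ 1 / (ℓ * x + 1) := by
        rw [Real.exp_neg, ← one_div]
        exact one_div_le_one_div_of_le (by positivity) g1
      rw [show 1 + 1 / (ℓ * x) = (1 - 1 / (ℓ * x + 1))⁻¹ by field_simp; ring]
      refine inv_anti₀ ?_ (by linarith)
      rw [sub_pos, div_lt_one (by positivity)]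
      linarith
    have f3 : 1 / (ℓ * x) ≤ 1 / (2 * x) := by gcongr
    have f4 : 1 / x = 1 / (2 * x) + 1 / (2 * x) := by field_simp; norm_num
    linarith
  have b3 : 1 / (2 * x) = 1 / (4 * x) + 1 / (4 * x) := by field_simp; norm_num
  have h5 : ‖regularGen ℓ q‖ * Real.exp (1 / (4 * x) - 1 / 2) ≤
      ‖regularGen ℓ (Complex.exp (-x))‖ := by
    refine le_trans ?_ h
    exact mul_le_mul_of_nonneg_left (Real.exp_le_exp.mpr (by linarith)) (norm_nonneg _)
  rw [show 1 / 2 - 1 / (4 * x) = -(1 / (4 * x) - 1 / 2) by ring, Real.exp_neg, ← div_eq_mul_inv]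
  exact (le_div_iff₀ (Real.exp_pos _)).mpr h5

/-! ### Behaviour at the cusp and the rescaled integrand. -/

/-- The coefficient `A` in `log F (exp (-t)) ∼ A / t`, where `F` is the generating function of
`r`-coloured `ℓ`-regular partitions. -/
noncomputable def growthRate (r ℓ : ℕ) : ℝ := 4 * Real.pi ^ 2 * (r / 24 * (1 - 1 / ℓ))

theorem growthRate_pos {r ℓ : ℕ} (hr : 1 ≤ r) (hℓ : 2 ≤ ℓ) : 0 < growthRate r ℓ := by
  have hl : (1 : ℝ) < ℓ := by exact_mod_cast hℓ
  have hr' : (0 : ℝ) < r := by exact_mod_cast hr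
  have : 0 < 1 - 1 / (ℓ : ℝ) := by
    rw [sub_pos, div_lt_one (by linarith)]
    exact hl
  have := Real.pi_pos
  rw [growthRate]
  positivity

/-- The factor of the generating function that tends to `1` at the cusp. -/
noncomputable def cuspFactor (r ℓ : ℕ) (t : ℂ) : ℂ :=
  (eulerProd (Complex.exp (-(4 * Real.pi ^ 2 / (ℓ * t)))) /
    eulerProd (Complex.exp (-(4 * Real.pi ^ 2 / t)))) ^ r

theorem regularGen_exp_neg_pow (r : ℕ) {ℓ : ℕ} (hℓ : 0 < ℓ) {t : ℂ} (ht : 0 < t.re) :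
    regularGen ℓ (Complex.exp (-t)) ^ r =
      (((Real.sqrt ℓ)⁻¹ ^ r : ℝ) : ℂ) * Complex.exp ((r * (ℓ - 1) / 24 : ℝ) * t) *
        Complex.exp (growthRate r ℓ / t) * cuspFactor r ℓ t := by
  have e1 : (r : ℂ) * ((ℓ - 1) / 24 * t) = (r * (ℓ - 1) / 24 : ℝ) * t := by
    push_cast
    ring
  have e2 : (r : ℂ) * (Real.pi ^ 2 / 6 * (1 - 1 / ℓ) / t) = growthRate r ℓ / t := by
    rw [growthRate]
    push_cast
    ring
  rw [regularGen_exp_neg hℓ ht, mul_pow, mul_pow, mul_pow, cuspFactor, ← Complex.exp_nat_mul,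
    ← Complex.exp_nat_mul, e1, e2, Complex.ofReal_pow, Complex.ofReal_inv]

/-- Since `|exp(-c/t)| = exp(-c Re(1/t))`, the natural filter is `Re(1/t) → ∞`: its neighbourhoods
are discs tangent to the imaginary axis at `0`. -/
theorem tendsto_eulerProd_exp_neg_div {c : ℝ} (hc : 0 < c) :
    Tendsto (fun t : ℂ => eulerProd (Complex.exp (-(c / t))))
      (comap (fun t : ℂ => (t⁻¹).re) atTop) (nhds 1) := by
  refine tendsto_eulerProd_zero.comp (tendsto_zero_iff_norm_tendsto_zero.mpr ?_)
  have h : Tendsto (fun t : ℂ => Real.exp (-(c * (t⁻¹).re))) (comap (fun t : ℂ => (t⁻¹).re) atTop)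
      (nhds 0) :=
    Real.tendsto_exp_neg_atTop_nhds_zero.comp (tendsto_comap.const_mul_atTop hc)
  refine h.congr fun t => ?_
  rw [Complex.norm_exp, Complex.neg_re, div_eq_mul_inv, Complex.re_ofReal_mul]

theorem tendsto_cuspFactor (r : ℕ) {ℓ : ℕ} (hℓ : 0 < ℓ) :
    Tendsto (cuspFactor r ℓ) (comap (fun t : ℂ => (t⁻¹).re) atTop) (nhds 1) := by
  have hl : (0 : ℝ) < ℓ := by exact_mod_cast hℓ
  have h1 := tendsto_eulerProd_exp_neg_div (c := 4 * Real.pi ^ 2 / ℓ) (by positivity)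
  have h2 := tendsto_eulerProd_exp_neg_div (c := 4 * Real.pi ^ 2) (by positivity)
  have h := (h1.div h2 one_ne_zero).pow r
  rw [div_one, one_pow] at h
  refine h.congr fun t => ?_
  rw [cuspFactor, Pi.div_apply]
  push_cast
  rw [div_div]

theorem exists_norm_cuspFactor_le (r : ℕ) {ℓ : ℕ} (hℓ : 0 < ℓ) :
    ∃ R : ℝ, 0 < R ∧ ∀ t : ℂ, R ≤ (t⁻¹).re → ‖cuspFactor r ℓ t‖ ≤ 2 := by
  have h : ∀ᶠ t in comap (fun t : ℂ => (t⁻¹).re) atTop, ‖cuspFactor r ℓ t‖ ≤ 2 :=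
    (tendsto_cuspFactor r hℓ).norm.eventually (by
      rw [norm_one]
      exact eventually_le_nhds one_lt_two)
  rw [eventually_comap] at h
  obtain ⟨R, hR⟩ := eventually_atTop.mp h
  exact ⟨max R 1, by positivity, fun t ht => hR _ (le_trans (le_max_left _ _) ht) t rfl⟩

/-- The integrand of Cauchy's formula on the saddle point circle of radius `exp (-s ^ 2)`, in the
angular variable scaled by `s ^ 3`, and normalised. -/
noncomputable def saddleIntegrand (r ℓ : ℕ) (s u : ℝ) : ℂ :=
  (Set.Ioc (-Real.pi) Real.pi).indicator (fun y : ℝ =>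
      regularGen ℓ (Complex.exp (-((s ^ 2 : ℝ) + y * Complex.I))) ^ r *
        Complex.exp ((growthRate r ℓ / s ^ 4 : ℝ) * ((s ^ 2 : ℝ) + y * Complex.I))) (s ^ 3 * u) *
    (((Real.sqrt ℓ)⁻¹ ^ r * Real.exp (2 * growthRate r ℓ / s ^ 2) : ℝ) : ℂ)⁻¹

theorem one_add_ofReal_mul_I_ne_zero (a : ℝ) : (1 + a * Complex.I : ℂ) ≠ 0 := by
  intro h
  have := congrArg Complex.re h
  simp at this

/-- With `w = 1 + i s u` and `t = s²w`, the exponent is `(A/s²)(1/w + w) = 2A/s² + (A/s²)(w -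
1)²/w`, and `(w - 1)² = -s²u²`. The normalisation removes `2A/s²`. -/
theorem saddleIntegrand_eq (r : ℕ) {ℓ : ℕ} (hℓ : 0 < ℓ) {s u : ℝ} (hs : 0 < s)
    (hu : s ^ 3 * u ∈ Set.Ioc (-Real.pi) Real.pi) :
    saddleIntegrand r ℓ s u =
      Complex.exp ((r * (ℓ - 1) / 24 : ℝ) * ((s ^ 2 : ℝ) + (s ^ 3 * u : ℝ) * Complex.I)) *
        Complex.exp (-(growthRate r ℓ * u ^ 2) / (1 + (s * u : ℝ) * Complex.I)) *
        cuspFactor r ℓ ((s ^ 2 : ℝ) + (s ^ 3 * u : ℝ) * Complex.I) := by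
  have hl : (0 : ℝ) < ℓ := by exact_mod_cast hℓ
  have hK : (((Real.sqrt ℓ)⁻¹ ^ r : ℝ) : ℂ) ≠ 0 := by
    have : (Real.sqrt ℓ)⁻¹ ^ r ≠ 0 := by positivity
    exact_mod_cast this
  have hs0 : (s : ℂ) ≠ 0 := by exact_mod_cast hs.ne'
  have h1 := one_add_ofReal_mul_I_ne_zero (s * u)
  have ht : 0 < ((s ^ 2 : ℝ) + (s ^ 3 * u : ℝ) * Complex.I : ℂ).re := by
    rw [Complex.add_re, Complex.re_ofReal_mul]
    simp only [Complex.ofReal_re, Complex.I_re, mul_zero, add_zero]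
    positivity
  have htt : ((s ^ 2 : ℝ) + (s ^ 3 * u : ℝ) * Complex.I : ℂ) =
      s ^ 2 * (1 + (s * u : ℝ) * Complex.I) := by
    push_cast
    ring
  have he : Complex.exp (-(growthRate r ℓ * u ^ 2) / (1 + (s * u : ℝ) * Complex.I)) =
      Complex.exp (growthRate r ℓ / ((s ^ 2 : ℝ) + (s ^ 3 * u : ℝ) * Complex.I)) *
        Complex.exp ((growthRate r ℓ / s ^ 4 : ℝ) *
          ((s ^ 2 : ℝ) + (s ^ 3 * u : ℝ) * Complex.I)) *
        (Complex.exp (2 * growthRate r ℓ / s ^ 2))⁻¹ := by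
    have hu2 : (u : ℂ) ^ 2 = -((1 + (s * u : ℝ) * Complex.I) - 1) ^ 2 / s ^ 2 := by
      rw [eq_div_iff (pow_ne_zero 2 hs0)]
      push_cast
      linear_combination (s ^ 2 * u ^ 2 : ℂ) * Complex.I_sq
    rw [← Complex.exp_neg, ← Complex.exp_add, ← Complex.exp_add, htt, hu2]
    congr 1
    generalize (1 + (s * u : ℝ) * Complex.I : ℂ) = w at h1
    push_cast
    field_simp
    ring
  rw [saddleIntegrand, Set.indicator_of_mem hu, regularGen_exp_neg_pow r hℓ ht, he,
    Complex.ofReal_mul ((Real.sqrt ℓ)⁻¹ ^ r), mul_inv]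
  push_cast at hK ⊢
  generalize ((Real.sqrt ℓ : ℂ)⁻¹ ^ r) = K at hK
  field_simp

theorem re_inv_scaled {s u : ℝ} (hs : 0 < s) :
    (((s ^ 2 : ℝ) + (s ^ 3 * u : ℝ) * Complex.I : ℂ)⁻¹).re =
      (s ^ 2)⁻¹ * (1 + (s * u) ^ 2)⁻¹ := by
  rw [Complex.inv_re, Complex.normSq_add_mul_I, Complex.add_re, Complex.re_ofReal_mul]
  simp only [Complex.ofReal_re, Complex.I_re, mul_zero, add_zero]
  field_simp

theorem tendsto_saddleIntegrand (r : ℕ) {ℓ : ℕ} (hℓ : 0 < ℓ) (u : ℝ) :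
    Tendsto (fun s => saddleIntegrand r ℓ s u) (nhdsWithin 0 (Set.Ioi 0))
      (nhds ((Real.exp (-growthRate r ℓ * u ^ 2) : ℝ) : ℂ)) := by
  have hev : ∀ᶠ s : ℝ in nhdsWithin 0 (Set.Ioi 0), s ^ 3 * u ∈ Set.Ioc (-Real.pi) Real.pi := by
    have hc : ContinuousAt (fun s : ℝ => s ^ 3 * u) 0 := by fun_prop
    refine nhdsWithin_le_nhds (hc.eventually ?_)
    beta_reduce
    rw [zero_pow three_ne_zero, zero_mul]
    exact Ioc_mem_nhds (by linarith [Real.pi_pos]) Real.pi_pos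
  have h1 : Tendsto (fun s : ℝ => Complex.exp ((r * (ℓ - 1) / 24 : ℝ) *
      ((s ^ 2 : ℝ) + (s ^ 3 * u : ℝ) * Complex.I))) (nhdsWithin 0 (Set.Ioi 0)) (nhds 1) := by
    have hc : Continuous (fun s : ℝ => Complex.exp ((r * (ℓ - 1) / 24 : ℝ) *
      ((s ^ 2 : ℝ) + (s ^ 3 * u : ℝ) * Complex.I))) := by fun_prop
    have := hc.tendsto 0
    simp only [ne_eq, OfNat.ofNat_ne_zero, not_false_eq_true, zero_pow, zero_mul,
      Complex.ofReal_zero, add_zero, mul_zero, Complex.exp_zero] at this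
    exact this.mono_left nhdsWithin_le_nhds
  have h2 : Tendsto (fun s : ℝ => Complex.exp (-(growthRate r ℓ * u ^ 2) /
      (1 + (s * u : ℝ) * Complex.I))) (nhdsWithin 0 (Set.Ioi 0))
      (nhds ((Real.exp (-growthRate r ℓ * u ^ 2) : ℝ) : ℂ)) := by
    have hc : Continuous (fun s : ℝ => Complex.exp (-(growthRate r ℓ * u ^ 2) /
      (1 + (s * u : ℝ) * Complex.I))) := by
      refine Complex.continuous_exp.comp (Continuous.div (by fun_prop) (by fun_prop) fun s => ?_)
      exact one_add_ofReal_mul_I_ne_zero _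
    have := hc.tendsto 0
    simp only [zero_mul, Complex.ofReal_zero, add_zero, div_one] at this
    rw [neg_mul, Complex.ofReal_exp, Complex.ofReal_neg, Complex.ofReal_mul, Complex.ofReal_pow]
    exact this.mono_left nhdsWithin_le_nhds
  have h3 : Tendsto (fun s : ℝ => cuspFactor r ℓ ((s ^ 2 : ℝ) + (s ^ 3 * u : ℝ) * Complex.I))
      (nhdsWithin 0 (Set.Ioi 0)) (nhds 1) := by
    refine (tendsto_cuspFactor r hℓ).comp (tendsto_comap_iff.mpr ?_)
    have ha : Tendsto (fun s : ℝ => (s ^ 2)⁻¹) (nhdsWithin 0 (Set.Ioi 0)) atTop := by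
      refine tendsto_inv_nhdsGT_zero.comp (tendsto_nhdsWithin_iff.mpr ⟨?_, ?_⟩)
      · have hc : Continuous fun s : ℝ => s ^ 2 := by fun_prop
        have := hc.tendsto 0
        rw [zero_pow two_ne_zero] at this
        exact this.mono_left nhdsWithin_le_nhds
      · filter_upwards [self_mem_nhdsWithin] with s hs
        exact pow_pos (Set.mem_Ioi.mp hs) 2
    have hb : Tendsto (fun s : ℝ => (1 + (s * u) ^ 2)⁻¹) (nhdsWithin 0 (Set.Ioi 0)) (nhds 1) := by
      have hc : Continuous fun s : ℝ => (1 + (s * u) ^ 2)⁻¹ :=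
        Continuous.inv₀ (by fun_prop) fun s => by positivity
      have := hc.tendsto 0
      rw [zero_mul, zero_pow two_ne_zero, add_zero, inv_one] at this
      exact this.mono_left nhdsWithin_le_nhds
    refine (ha.atTop_mul_pos one_pos hb).congr' ?_
    filter_upwards [self_mem_nhdsWithin] with s hs
    exact (re_inv_scaled hs).symm
  have h := (h1.mul h2).mul h3
  rw [one_mul, mul_one] at h
  refine h.congr' ?_
  filter_upwards [hev, self_mem_nhdsWithin] with s hu hs
  exact (saddleIntegrand_eq r hℓ hs hu).symm

/-! ### An integrable bound uniform in the saddle parameter. -/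

theorem exp_neg_le_inv_one_add {v : ℝ} (hv : 0 ≤ v) : Real.exp (-v) ≤ (1 + v)⁻¹ := by
  rw [Real.exp_neg]
  exact inv_anti₀ (by positivity) (by linarith [Real.add_one_le_exp v])

/-- Near the saddle `1 + (su)² ≤ 65`. Hence `Re(1/t) ≥ 1/(65s²) ≥ R` controls the cusp factor, and
the exponent has real part at most `-A u²/65`. -/
theorem norm_saddleIntegrand_le_of_mul_le {r ℓ : ℕ} (hr : 1 ≤ r) (hℓ : 2 ≤ ℓ) {R s u : ℝ}
    (hR : ∀ t : ℂ, R ≤ (t⁻¹).re → ‖cuspFactor r ℓ t‖ ≤ 2) (hs : 0 < s) (hs1 : s ≤ 1)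
    (hsR : R * (65 * s ^ 2) ≤ 1) (hsu : s * |u| ≤ 8)
    (hu : s ^ 3 * u ∈ Set.Ioc (-Real.pi) Real.pi) :
    ‖saddleIntegrand r ℓ s u‖ ≤ 2 * Real.exp (r * (ℓ - 1) / 24) *
      (1 + growthRate r ℓ * u ^ 2 / 65)⁻¹ := by
  have hA := growthRate_pos hr hℓ
  have hl : (2 : ℝ) ≤ ℓ := by exact_mod_cast hℓ
  have hD : 0 ≤ (r * (ℓ - 1) / 24 : ℝ) := by
    have : (0 : ℝ) ≤ ℓ - 1 := by linarith
    positivity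
  have h65 : 1 + (s * u) ^ 2 ≤ 65 := by
    have : (s * |u|) ^ 2 ≤ 8 ^ 2 := by gcongr
    rw [mul_pow, sq_abs, ← mul_pow] at this
    linarith
  rw [saddleIntegrand_eq r (by omega) hs hu, norm_mul, norm_mul, Complex.norm_exp,
    Complex.norm_exp]
  have n1 : ((r * (ℓ - 1) / 24 : ℝ) * ((s ^ 2 : ℝ) + (s ^ 3 * u : ℝ) * Complex.I) : ℂ).re ≤
      r * (ℓ - 1) / 24 := by
    rw [Complex.re_ofReal_mul, Complex.add_re, Complex.re_ofReal_mul]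
    simp only [Complex.ofReal_re, Complex.I_re, mul_zero, add_zero]
    exact mul_le_of_le_one_right hD (pow_le_one₀ hs.le hs1)
  have n2 : (-(growthRate r ℓ * u ^ 2) / (1 + (s * u : ℝ) * Complex.I) : ℂ).re ≤
      -(growthRate r ℓ * u ^ 2 / 65) := by
    have e : (-(growthRate r ℓ * u ^ 2) : ℂ) = ((-(growthRate r ℓ * u ^ 2) : ℝ) : ℂ) := by
      push_cast
      ring
    rw [e, re_ofReal_div, Complex.add_re, Complex.add_im, Complex.re_ofReal_mul,
      Complex.im_ofReal_mul]
    simp only [Complex.one_re, Complex.one_im, Complex.I_re, Complex.I_im, mul_zero, mul_one,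
      add_zero, zero_add, one_pow]
    rw [neg_div]
    gcongr
  have n3 : ‖cuspFactor r ℓ ((s ^ 2 : ℝ) + (s ^ 3 * u : ℝ) * Complex.I)‖ ≤ 2 := by
    refine hR _ ?_
    rw [re_inv_scaled hs, ← mul_inv, ← one_div, le_div_iff₀ (by positivity)]
    rcases le_or_gt R 0 with h | h
    · exact (mul_nonpos_of_nonpos_of_nonneg h (by positivity)).trans zero_le_one
    · refine le_trans ?_ hsR
      rw [mul_comm 65]
      gcongr
  calc _ ≤ Real.exp (r * (ℓ - 1) / 24) * Real.exp (-(growthRate r ℓ * u ^ 2 / 65)) * 2 := by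
        gcongr
    _ ≤ Real.exp (r * (ℓ - 1) / 24) * (1 + growthRate r ℓ * u ^ 2 / 65)⁻¹ * 2 := by
        gcongr
        exact exp_neg_le_inv_one_add (by positivity)
    _ = _ := by ring

/-- Times `s²`, the condition `8 ≤ s|u|` reads `8x ≤ |y|` with `x = s²` and `y = s³u`, so the bound
off the real axis applies; the other factors have modulus independent of `u`. -/
theorem norm_saddleIntegrand_le_of_lt_mul {r ℓ : ℕ} (hr : 1 ≤ r) (hℓ : 2 ≤ ℓ) {s u : ℝ}
    (hs : 0 < s) (hs1 : s ≤ 1 / 2) (hsu : 8 ≤ s * |u|)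
    (hu : s ^ 3 * u ∈ Set.Ioc (-Real.pi) Real.pi) :
    ‖saddleIntegrand r ℓ s u‖ ≤
      ‖saddleIntegrand r ℓ s 0‖ * Real.exp (1 / 2 - 1 / (4 * s ^ 2)) := by
  have hs2 : s ^ 2 ≤ 1 / 4 := by nlinarith
  have h := norm_regularGen_exp_neg_le hℓ (x := s ^ 2) (y := s ^ 3 * u) (by positivity) hs2
    (by
      rw [abs_mul, abs_of_pos (by positivity)]
      nlinarith [mul_le_mul_of_nonneg_left hsu (sq_nonneg s)])
    (abs_le.mpr ⟨hu.1.le, hu.2⟩)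
  have h0 : s ^ 3 * 0 ∈ Set.Ioc (-Real.pi) Real.pi := by
    rw [mul_zero]
    exact ⟨by linarith [Real.pi_pos], Real.pi_pos.le⟩
  have hneg : Real.exp (1 / 2 - 1 / (4 * s ^ 2)) ≤ 1 := by
    rw [Real.exp_le_one_iff, sub_nonpos]
    refine one_div_le_one_div_of_le (by positivity) (by linarith)
  have hpow : ‖regularGen ℓ (Complex.exp (-((s ^ 2 : ℝ) + (s ^ 3 * u : ℝ) * Complex.I)))‖ ^ r ≤
      ‖regularGen ℓ (Complex.exp (-((s ^ 2 : ℝ) : ℂ)))‖ ^ r *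
        Real.exp (1 / 2 - 1 / (4 * s ^ 2)) := by
    refine (pow_le_pow_left₀ (norm_nonneg _) h r).trans ?_
    rw [mul_pow]
    gcongr
    -- Of the `r ≥ 1` small factors, one is enough.
    exact pow_le_of_le_one (Real.exp_pos _).le hneg (by omega)
  rw [saddleIntegrand, saddleIntegrand, Set.indicator_of_mem hu, Set.indicator_of_mem h0]
  simp only [norm_mul, norm_pow, Complex.norm_exp, Complex.re_ofReal_mul, Complex.add_re,
    Complex.ofReal_re, Complex.I_re, mul_zero, add_zero, Complex.ofReal_zero, zero_mul]
  calc _ ≤ _ := mul_le_mul_of_nonneg_right (mul_le_mul_of_nonneg_right hpow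
        (Real.exp_pos _).le) (norm_nonneg _)
    _ = _ := by ring

/-- The cubic term of the exponential series, with `384 = 4³ · 3!`. With `x = s²`, the power `x³ =
s⁶` is what is needed against `u² ≤ π²/s⁶`. -/
theorem exp_neg_inv_le {x : ℝ} (hx : 0 < x) : Real.exp (-(1 / (4 * x))) ≤ 384 * x ^ 3 := by
  have h := Real.pow_div_factorial_le_exp (1 / (4 * x)) (by positivity) 3
  rw [Real.exp_neg, ← one_div]
  refine (one_div_le_one_div_of_le (by positivity) h).trans (le_of_eq ?_)
  norm_num [Nat.factorial]
  field_simp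
  norm_num

theorem exists_norm_saddleIntegrand_le {r ℓ : ℕ} (hr : 1 ≤ r) (hℓ : 2 ≤ ℓ) :
    ∃ C : ℝ, ∀ᶠ s in nhdsWithin 0 (Set.Ioi 0), ∀ u : ℝ,
      ‖saddleIntegrand r ℓ s u‖ ≤ C * (1 + u ^ 2)⁻¹ := by
  obtain ⟨R, hR0, hR⟩ := exists_norm_cuspFactor_le r (by omega : 0 < ℓ)
  have hA := growthRate_pos hr hℓ
  set E := 2 * Real.exp (r * (ℓ - 1) / 24) with hE
  have hEpos : 0 < E := by positivity
  refine ⟨E * ((1 + 65 / growthRate r ℓ) + Real.exp (1 / 2) * 6000), ?_⟩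
  have hev : ∀ᶠ s : ℝ in nhdsWithin 0 (Set.Ioi 0), R * (65 * s ^ 2) ≤ 1 := by
    have hc : ContinuousAt (fun s : ℝ => R * (65 * s ^ 2)) 0 := by fun_prop
    refine nhdsWithin_le_nhds (hc.tendsto.eventually (p := fun v => v ≤ 1) ?_)
    rw [zero_pow two_ne_zero, mul_zero, mul_zero]
    exact eventually_le_nhds zero_lt_one
  filter_upwards [hev, Ioc_mem_nhdsGT (show (0 : ℝ) < 1 / 2 by norm_num)] with s hsR ⟨hs, hs1⟩ u
  by_cases hu : s ^ 3 * u ∈ Set.Ioc (-Real.pi) Real.pi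
  · rcases le_total (s * |u|) 8 with hsu | hsu
    · refine (norm_saddleIntegrand_le_of_mul_le hr hℓ hR hs (by linarith) hsR hsu hu).trans ?_
      rw [← hE, mul_assoc E]
      refine mul_le_mul_of_nonneg_left ?_ hEpos.le
      calc (1 + growthRate r ℓ * u ^ 2 / 65)⁻¹ ≤ (1 + 65 / growthRate r ℓ) * (1 + u ^ 2)⁻¹ := by
            rw [← div_eq_mul_inv, le_div_iff₀ (by positivity), inv_mul_le_iff₀ (by positivity)]
            have e : (1 + growthRate r ℓ * u ^ 2 / 65) * (1 + 65 / growthRate r ℓ) =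
                1 + u ^ 2 + (65 / growthRate r ℓ + growthRate r ℓ * u ^ 2 / 65) := by
              field_simp
              ring
            rw [e]
            have : 0 ≤ 65 / growthRate r ℓ + growthRate r ℓ * u ^ 2 / 65 := by positivity
            linarith
        _ ≤ _ := by
            refine mul_le_mul_of_nonneg_right ?_ (by positivity)
            exact le_add_of_nonneg_right (by positivity)
    · have h0 := norm_saddleIntegrand_le_of_mul_le hr hℓ hR hs (by linarith) hsR (u := 0)
        (by simp) (by
          rw [mul_zero]
          exact ⟨by linarith [Real.pi_pos], Real.pi_pos.le⟩)
      rw [zero_pow two_ne_zero, mul_zero, zero_div, add_zero, inv_one, mul_one, ← hE] at h0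
      refine (norm_saddleIntegrand_le_of_lt_mul hr hℓ hs hs1 hsu hu).trans ?_
      have h1 := exp_neg_inv_le (pow_pos hs 2)
      have h2 : (s ^ 3 * u) ^ 2 ≤ Real.pi ^ 2 := sq_le_sq' hu.1.le hu.2
      have h3 : s ^ 6 ≤ 1 := pow_le_one₀ hs.le (by linarith)
      -- Here `s⁶(1 + u²) ≤ 1 + π²`, and `384(1 + π²) < 6000`.
      have h4 : 384 * (s ^ 2) ^ 3 ≤ 6000 * (1 + u ^ 2)⁻¹ := by
        rw [← div_eq_mul_inv, le_div_iff₀ (by positivity)]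
        nlinarith [Real.pi_lt_d2, Real.pi_pos]
      calc ‖saddleIntegrand r ℓ s 0‖ * Real.exp (1 / 2 - 1 / (4 * s ^ 2))
          ≤ E * (Real.exp (1 / 2) * (6000 * (1 + u ^ 2)⁻¹)) := by
            rw [sub_eq_add_neg, Real.exp_add]
            gcongr
            exact h1.trans h4
        _ ≤ _ := by
            rw [mul_assoc E, add_mul, mul_assoc (Real.exp (1 / 2))]
            gcongr
            have : 0 ≤ (1 + 65 / growthRate r ℓ) * (1 + u ^ 2)⁻¹ := by positivity
            linarith
  · rw [saddleIntegrand, Set.indicator_of_notMem hu, zero_mul, norm_zero]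
    positivity

/-! ### Passage to the Gaussian limit and the asymptotic formula. -/

theorem continuous_regularGen_exp {ℓ : ℕ} (hℓ : 0 < ℓ) {x : ℝ} (hx : 0 < x) :
    Continuous fun y : ℝ => regularGen ℓ (Complex.exp (-(x + y * Complex.I))) := by
  have hq : ∀ y : ℝ, ‖Complex.exp (-(x + y * Complex.I))‖ < 1 := fun y =>
    norm_exp_neg_lt_one (by simpa using hx)
  refine Continuous.div (continuousOn_eulerProd.comp_continuous (by fun_prop) fun y => ?_)
    (continuousOn_eulerProd.comp_continuous (by fun_prop) fun y => ?_)
    fun y => eulerProd_ne_zero (hq y)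
  · exact mem_ball_zero_iff.mpr (norm_pow_lt_one (hq y) hℓ)
  · exact mem_ball_zero_iff.mpr (hq y)

theorem measurable_saddleIntegrand (r : ℕ) {ℓ : ℕ} (hℓ : 0 < ℓ) {s : ℝ} (hs : 0 < s) :
    Measurable (saddleIntegrand r ℓ s) := by
  refine Measurable.mul_const ?_ _
  refine Measurable.comp (g := Set.indicator _ _) ?_ (measurable_const_mul (s ^ 3))
  refine Measurable.indicator (Continuous.measurable ?_) measurableSet_Ioc
  exact ((continuous_regularGen_exp hℓ (by positivity)).pow r).mul (by fun_prop)

theorem tendsto_integral_saddleIntegrand {r ℓ : ℕ} (hr : 1 ≤ r) (hℓ : 2 ≤ ℓ) :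
    Tendsto (fun s => ∫ u, saddleIntegrand r ℓ s u) (nhdsWithin 0 (Set.Ioi 0))
      (nhds ((Real.sqrt (Real.pi / growthRate r ℓ) : ℝ) : ℂ)) := by
  obtain ⟨C, hC⟩ := exists_norm_saddleIntegrand_le hr hℓ
  rw [← integral_gaussian, ← integral_complex_ofReal]
  refine MeasureTheory.tendsto_integral_filter_of_dominated_convergence
    (fun u => C * (1 + u ^ 2)⁻¹) ?_ ?_ (integrable_inv_one_add_sq.const_mul C)
    (Eventually.of_forall fun u => tendsto_saddleIntegrand r (by omega) u)
  · filter_upwards [self_mem_nhdsWithin] with s hs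
    exact (measurable_saddleIntegrand r (by omega) hs).aestronglyMeasurable
  · filter_upwards [hC] with s hs
    exact Eventually.of_forall hs

/-- Undoing `y = s³u` recovers Cauchy's integral over one period, with Jacobian `s^(-3)`. -/
theorem integral_saddleIntegrand (r : ℕ) {ℓ : ℕ} (hℓ : 0 < ℓ) {s : ℝ} (hs : 0 < s) (n : ℕ)
    (hn : growthRate r ℓ / s ^ 4 = n) :
    ∫ u, saddleIntegrand r ℓ s u =
      ((2 * Real.pi * coloredRegularCount r ℓ n / (s ^ 3 * ((Real.sqrt ℓ)⁻¹ ^ r *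
        Real.exp (2 * growthRate r ℓ / s ^ 2))) : ℝ) : ℂ) := by
  simp only [saddleIntegrand, hn]
  rw [MeasureTheory.integral_mul_const, MeasureTheory.Measure.integral_comp_mul_left
    (fun v => Set.indicator _ _ v), MeasureTheory.integral_indicator measurableSet_Ioc,
    ← intervalIntegral.integral_of_le (by linarith [Real.pi_pos])]
  have h := integral_regularGen_pow r hℓ n (pow_pos hs 2)
  push_cast at h ⊢
  rw [h, abs_of_pos (by positivity), Complex.real_smul]
  push_cast
  rw [div_eq_mul_inv, mul_inv]
  ring

/-- As `n → ∞`, `b_ℓ^{(r)}(n) ∼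
2^{-1/2} (1/ℓ)^{r/2} ((r/24)(1 - 1/ℓ))^{1/4} (1/n)^{3/4} exp (4π √((n r/24)(1 - 1/ℓ)))`. -/
theorem mainTheorem2 (r ℓ : ℕ) (hr : 1 ≤ r) (hℓ : 2 ≤ ℓ) :
    (fun n : ℕ => (coloredRegularCount r ℓ n : ℝ)) ~[atTop]
      (fun n : ℕ =>
        1 / Real.sqrt 2 * (1 / (ℓ : ℝ)) ^ ((r : ℝ) / 2) *
          ((r : ℝ) / 24 * (1 - 1 / (ℓ : ℝ))) ^ ((1 : ℝ) / 4) *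
          (1 / (n : ℝ)) ^ ((3 : ℝ) / 4) *
          Real.exp (4 * Real.pi * Real.sqrt ((n : ℝ) * (r : ℝ) / 24 * (1 - 1 / (ℓ : ℝ))))) := by
  have hA := growthRate_pos hr hℓ
  have hl : (0 : ℝ) < ℓ := by
    have : 0 < ℓ := by omega
    exact_mod_cast this
  set B : ℝ := (r : ℝ) / 24 * (1 - 1 / (ℓ : ℝ)) with hB
  have hAB : growthRate r ℓ = 4 * Real.pi ^ 2 * B := rfl
  have hπ := Real.pi_pos
  have hBpos : 0 < B := by
    rw [hAB] at hA
    exact pos_of_mul_pos_right hA (by positivity)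
  set β : ℝ := B ^ ((1 : ℝ) / 4) with hβ
  have hβpos : 0 < β := Real.rpow_pos_of_pos hBpos _
  have hβ4 : β ^ 4 = B := by
    rw [hβ, ← Real.rpow_natCast, ← Real.rpow_mul hBpos.le]
    norm_num
  set ν : ℕ → ℝ := fun n => (1 / (n : ℝ)) ^ ((1 : ℝ) / 4) with hν
  have hν4 : ∀ n, ν n ^ 4 = 1 / (n : ℝ) := fun n => by
    rw [hν, ← Real.rpow_natCast, ← Real.rpow_mul (by positivity)]
    norm_num
  have hν3 : ∀ n : ℕ, (1 / (n : ℝ)) ^ ((3 : ℝ) / 4) = ν n ^ 3 := fun n => by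
    rw [hν, ← Real.rpow_natCast, ← Real.rpow_mul (by positivity)]
    norm_num
  have hνpos : ∀ n : ℕ, 0 < n → 0 < ν n := fun n hn => by
    have : (0 : ℝ) < n := by exact_mod_cast hn
    exact Real.rpow_pos_of_pos (by positivity) _
  have hνlim : Tendsto ν atTop (nhds 0) := by
    have h := (tendsto_one_div_atTop_nhds_zero_nat (𝕜 := ℝ)).rpow_const
      (p := (1 : ℝ) / 4) (Or.inr (by norm_num))
    rwa [Real.zero_rpow (by norm_num)] at h
  have hK : (1 / (ℓ : ℝ)) ^ ((r : ℝ) / 2) = (Real.sqrt ℓ)⁻¹ ^ r := by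
    rw [← Real.sqrt_inv, Real.sqrt_eq_rpow, ← Real.rpow_natCast, ← Real.rpow_mul (by positivity),
      one_div]
    congr 1
    ring
  -- This is `(A/n)^(1/4)`, because `A = 4π²B`; it tends to `0` through positive values.
  set s : ℕ → ℝ := fun n => Real.sqrt (2 * Real.pi) * β * ν n with hs
  have hspos : ∀ n : ℕ, 0 < n → 0 < s n := fun n hn => by
    have := hνpos n hn
    positivity
  have hq2 : Real.sqrt (2 * Real.pi) ^ 2 = 2 * Real.pi := Real.sq_sqrt (by positivity)
  have hs2 : ∀ n, s n ^ 2 = 2 * Real.pi * β ^ 2 * ν n ^ 2 := fun n => by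
    rw [hs, mul_pow, mul_pow, hq2]
  have hslim : Tendsto s atTop (nhdsWithin 0 (Set.Ioi 0)) := by
    refine tendsto_nhdsWithin_iff.mpr ⟨?_, ?_⟩
    · have h := hνlim.const_mul (Real.sqrt (2 * Real.pi) * β)
      rwa [mul_zero] at h
    · filter_upwards [eventually_gt_atTop 0] with n hn
      exact hspos n hn
  have hlim := (tendsto_integral_saddleIntegrand hr hℓ).comp hslim
  have hreal := (Complex.continuous_re.tendsto _).comp hlim
  rw [Complex.ofReal_re] at hreal
  have hG : Real.sqrt (Real.pi / growthRate r ℓ) ≠ 0 :=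
    (Real.sqrt_pos.mpr (by positivity)).ne'
  have hone := hreal.div_const (Real.sqrt (Real.pi / growthRate r ℓ))
  rw [div_self hG] at hone
  refine isEquivalent_of_tendsto_one (hone.congr' ?_)
  filter_upwards [eventually_gt_atTop 0] with n hn
  have hn' : (0 : ℝ) < n := by exact_mod_cast hn
  have hνn := hνpos n hn
  have hsn := hspos n hn
  have hcond : growthRate r ℓ / s n ^ 4 = n := by
    rw [show s n ^ 4 = (s n ^ 2) ^ 2 by ring, hs2, hAB, ← hβ4]
    have : (2 * Real.pi * β ^ 2 * ν n ^ 2) ^ 2 = 4 * Real.pi ^ 2 * β ^ 4 * ν n ^ 4 := by ring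
    rw [this, hν4]
    field_simp
  simp only [Function.comp_apply, Pi.div_apply]
  rw [integral_saddleIntegrand r (by omega) hsn n hcond, Complex.ofReal_re, hν3, hK]
  have hexp : 2 * growthRate r ℓ / s n ^ 2 =
      4 * Real.pi * Real.sqrt ((n : ℝ) * (r : ℝ) / 24 * (1 - 1 / (ℓ : ℝ))) := by
    have : (n : ℝ) * (r : ℝ) / 24 * (1 - 1 / (ℓ : ℝ)) = (β ^ 2 / ν n ^ 2) ^ 2 := by
      have h4 := hν4 n
      rw [div_pow, ← pow_mul, ← pow_mul, hβ4, h4, hB]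
      field_simp
    rw [this, Real.sqrt_sq (by positivity), hs2, hAB, ← hβ4]
    field_simp
  rw [hexp]
  -- The value is `1/(2√(πB))`, written so that its `√(2π)` cancels the one in `s³`, leaving the
  -- constant `1/√2`.
  have hgauss : Real.sqrt (Real.pi / growthRate r ℓ) =
      1 / (Real.sqrt 2 * Real.sqrt (2 * Real.pi) * β ^ 2) := by
    rw [Real.sqrt_eq_iff_mul_self_eq (by positivity) (by positivity), hAB, ← hβ4]
    have e2 : Real.sqrt 2 ^ 2 = 2 := Real.sq_sqrt (by norm_num)
    have : 1 / (Real.sqrt 2 * Real.sqrt (2 * Real.pi) * β ^ 2) *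
        (1 / (Real.sqrt 2 * Real.sqrt (2 * Real.pi) * β ^ 2)) =
        1 / (Real.sqrt 2 ^ 2 * Real.sqrt (2 * Real.pi) ^ 2 * β ^ 4) := by ring
    rw [this, e2, hq2]
    field_simp
    norm_num
  rw [hgauss, show s n ^ 3 = s n ^ 2 * s n by ring, hs2]
  simp only [hs]
  have hK0 : (Real.sqrt ℓ)⁻¹ ^ r ≠ 0 := by positivity
  generalize (Real.sqrt ℓ)⁻¹ ^ r = K at hK0
  field_simp
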